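/- Algebras are of a fixed (set-sized) type whose operations may have infinite arities unless otherwise stated; empty algebras are allowed when there are no zeroary operations. A class $\mathbf{P}$ of algebras is a *prevariety* if every algebra isomorphic to a subalgebra of a member of $\mathbf{P}$, and every algebra isomorphic to a direct product of a (possibly empty) set-indexed family of members of $\mathbf{P}$, is in $\mathbf{P}$. The prevariety *generated* by a class of algebras is the least prevariety containing it. A prevariety is *residually small* if it is generated as a prevariety by a set of algebras. A prevariety $\mathbf{P}$ is a *quasivariety* if all operations have finite arity and $\mathbf{P}$ can be defined by a class of conditions of the form $(\forall x\in A^I)\ \bigl(\bigwedge_{j\in J} a_j(x)=b_j(x)\bigr)\Rightarrow c(x)=d(x)$, where $I$ and $J$ are finite sets and $a_j,b_j,c,d$ are $I$-ary terms. A set $\mathbf{X}$ of algebras in $\mathbf{P}$ is *$\mathbf{P}$-compatible* if for every $A_0\in\mathbf{X}$ the coprojection $A_0\to\coprod_{\mathbf{P}}^{A\in\mathbf{X}}A$ into the coproduct in $\mathbf{P}$ of the members of $\mathbf{X}$ is one-to-one. An algebra $A$ of $\mathbf{P}$ is *subdirectly irreducible* in $\mathbf{P}$ if for every (possibly empty)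 family of surjective homomorphisms $A\to B_i$ with all $B_i$ in $\mathbf{P}$ that together separate the elements of $A$, one of these homomorphisms is an isomorphism. (In particular $A$ has at least two elements.) **Theorem 7.2.** Let $\mathbf{P}$ be a residually small prevariety and $\kappa$ a cardinal. Consider the conditions 1. $\mathbf{P}$ can be generated, as a prevariety, by a set of at most $\kappa$ algebras. 2. Every set $\mathbf{X}$ of algebras subdirectly irreducible in $\mathbf{P}$ can be written as the union of at most $\kappa$ subsets $\mathbf{X}_\alpha$ $(\alpha\in\kappa)$, each of which is $\mathbf{P}$-compatible. Then (1) implies (2); and if $\mathbf{P}$ is a quasivariety, (1) and (2) are equivalent. -/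

import Mathlib

universe u

namespace UnivAlg

/-- A type of algebras: a set of primitive operation symbols, each with an arity,
which is an arbitrary set (not necessarily finite, possibly empty). -/
structure Signature : Type (u + 1) where
  Op : Type u
  Arity : Op → Type u

/-- An algebra of the given type, on a carrier set. The empty carrier is allowed
(it can occur only when there are no zeroary operations). -/
structure Alg (S : Signature.{u}) : Type (u + 1) where
  carrier : Type u
  op : (o : S.Op) → (S.Arity o → carrier) → carrier

instance {S : Signature.{u}} : CoeSort (Alg S) (Type u) := ⟨Alg.carrier⟩

/-- Homomorphisms of algebras. -/
structure Hom {S : Signature.{u}} (A B : Alg S) : Type u where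
  toFun : A → B
  map_op : ∀ (o : S.Op) (x : S.Arity o → A), toFun (A.op o x) = B.op o (fun k => toFun (x k))

instance {S : Signature.{u}} (A B : Alg S) : CoeFun (Hom A B) (fun _ => A → B) := ⟨Hom.toFun⟩

/-- The direct product of a family of algebras (for the empty family, the one-element algebra). -/
def prod {S : Signature.{u}} {ι : Type u} (B : ι → Alg S) : Alg S where
  carrier := (i : ι) → B i
  op := fun o x i => (B i).op o (fun k => x k i)

/-- The operator `𝕊`: algebras embeddable in a member of `X`, that is, isomorphic to a
subalgebra of a member of `X`. -/
def opS {S : Signature.{u}} (X : Set (Alg S)) : Set (Alg S) :=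
  {A | ∃ B ∈ X, ∃ f : Hom A B, Function.Injective f}

/-- The operator `Pr`: algebras isomorphic to the direct product of a (set-indexed, possibly
empty) family of members of `X`. -/
def opPr {S : Signature.{u}} (X : Set (Alg S)) : Set (Alg S) :=
  {A | ∃ (ι : Type u) (B : ι → Alg S), (∀ i, B i ∈ X) ∧
    ∃ f : Hom A (prod B), Function.Bijective f}

/-- A prevariety is a class of algebras closed under `𝕊` and `Pr`. -/
def IsPrevariety {S : Signature.{u}} (P : Set (Alg S)) : Prop :=
  opS P ⊆ P ∧ opPr P ⊆ P

/-- `P` is the prevariety generated by the class `Y`: the least prevariety containing `Y`. -/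
def GeneratesPrevariety {S : Signature.{u}} (Y P : Set (Alg S)) : Prop :=
  IsLeast {Q : Set (Alg S) | IsPrevariety Q ∧ Y ⊆ Q} P

/-- A class is residually small if it is generated as a prevariety by a set of algebras. -/
def ResiduallySmall {S : Signature.{u}} (P : Set (Alg S)) : Prop :=
  ∃ Y : Set (Alg S), Small.{u} Y ∧ GeneratesPrevariety Y P

/-- Terms in the operations of `S`, over a set `V` of variables. -/
inductive Term (S : Signature.{u}) (V : Type u) : Type u
  | var : V → Term S V
  | app : (o : S.Op) → (S.Arity o → Term S V) → Term S V

/-- The value of a term under an assignment of the variables. -/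
def Term.eval {S : Signature.{u}} {V : Type u} (A : Alg S) (x : V → A) : Term S V → A
  | .var v => x v
  | .app o t => A.op o (fun k => (t k).eval A x)

/-- A condition `(∀ x ∈ A^I) (⋀_{j ∈ J} a_j(x) = b_j(x)) ⟹ c(x) = d(x)`. -/
structure Horn (S : Signature.{u}) : Type (u + 1) where
  I : Type u
  J : Type u
  a : J → Term S I
  b : J → Term S I
  c : Term S I
  d : Term S I

/-- The algebra `A` satisfies the condition `h`. -/
def Horn.Holds {S : Signature.{u}} (h : Horn S) (A : Alg S) : Prop :=
  ∀ x : h.I → A, (∀ j, (h.a j).eval A x = (h.b j).eval A x) → h.c.eval A x = h.d.eval A x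

/-- A quasivariety: a prevariety of finitary algebras that can be defined by a class of
conditions `Horn` in each of which `I` and `J` are finite. -/
def IsQuasivariety {S : Signature.{u}} (P : Set (Alg S)) : Prop :=
  (∀ o : S.Op, Finite (S.Arity o)) ∧ IsPrevariety P ∧
    ∃ H : Set (Horn S), (∀ h ∈ H, Finite h.I ∧ Finite h.J) ∧ P = {A | ∀ h ∈ H, h.Holds A}

/-- `B`, with coprojections `q`, is a coproduct in `P` of the family `A`. -/
def IsCoproduct {S : Signature.{u}} (P : Set (Alg S)) {ι : Type*} (A : ι → Alg S)
    (B : Alg S) (q : (i : ι) → Hom (A i) B) : Prop :=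
  B ∈ P ∧ ∀ C ∈ P, ∀ g : (i : ι) → Hom (A i) C, ∃! h : Hom B C, ∀ i x, h (q i x) = g i x

/-- A set `X` of algebras of `P` is `P`-compatible if all coprojections from members of `X` to
the coproduct in `P` of the members of `X` are one-to-one. -/
def Compatible {S : Signature.{u}} (P X : Set (Alg S)) : Prop :=
  X ⊆ P ∧ ∃ (B : Alg S) (q : (A : X) → Hom A.1 B),
    IsCoproduct P (fun A : X => A.1) B q ∧ ∀ A : X, Function.Injective (q A)

/-- `A` is a subdirectly irreducible algebra of `P`: it belongs to `P`, and whenever it is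
represented as a subdirect product of a family of algebras `B i` of `P` (by surjections
`f i : A → B i` that together separate the elements of `A`), some projection `f i` is an
isomorphism. The empty family is allowed, so `A` has at least two elements. -/
def SubdirectlyIrreducible {S : Signature.{u}} (P : Set (Alg S)) (A : Alg S) : Prop :=
  A ∈ P ∧ ∀ (ι : Type u) (B : ι → Alg S) (f : (i : ι) → Hom A (B i)),
    (∀ i, B i ∈ P) → (∀ i, Function.Surjective (f i)) →
    (∀ x y : A, (∀ i, f i x = f i y) → x = y) → ∃ i, Function.Bijective (f i)

/-- `P` can be generated, as a prevariety, by a set of at most `κ` algebras. -/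
def GeneratedByAtMost {S : Signature.{u}} (P : Set (Alg S)) (κ : Cardinal.{u}) : Prop :=
  ∃ Y : Set (Alg S), Cardinal.mk Y ≤ Cardinal.lift.{u + 1} κ ∧ GeneratesPrevariety Y P

/-- Every set `X` of subdirectly irreducible algebras of `P` is the union of at most `κ`
subsets (a family indexed by a set of cardinality `κ`), each of them `P`-compatible. -/
def DecomposesIntoCompatible {S : Signature.{u}} (P : Set (Alg S)) (κ : Cardinal.{u}) : Prop :=
  ∀ X : Set (Alg S), Small.{u} X → (∀ A ∈ X, SubdirectlyIrreducible P A) →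
    ∃ F : κ.out → Set (Alg S), X = ⋃ α, F α ∧ ∀ α, Compatible P (F α)

end UnivAlg

/-!
The prevariety generated by a class `Y` consists of the algebras whose points are separated by
homomorphisms into members of `Y` (`GeneratesPrevariety.separated`). Applied to a subdirectly
irreducible algebra, this says that it embeds in a single member of `Y`
(`SubdirectlyIrreducible.exists_embedding`).

If `Y` generates `P`, split a set `X` of subdirectly irreducibles according to the member of `Y` in
which they embed. The coproduct of such a piece maps to the common target, extending the chosen
embeddings, so its coprojections are injective (`compatible_of_embeddings`). Coproducts exist in
every prevariety (`exists_isCoproduct`): divide the term algebra on the disjoint union of the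
carriers by the relation of being identified by all evaluations in members of `P`.

Conversely, let `P` be a residually small quasivariety. The subdirectly irreducibles form a set up
to isomorphism, since each embeds in a member of a generating set. Decompose that set into `κ`
compatible pieces and let `Y` consist of the coproducts of the pieces: every subdirectly
irreducible embeds in a member of `Y`. Since the defining conditions of `P` are finitary, unions of
chains of congruences with quotient in `P` are again of this kind
(`IsQuasivariety.quotient_chainUnion_mem`), so by Zorn's lemma any two distinct points of a member
of `P` are separated by a map onto a subdirectly irreducible
(`IsQuasivariety.exists_subdirectlyIrreducible`). Hence `Y` generates `P`.
-/

namespace UnivAlg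

variable {S : Signature.{u}}

/-! ### Homomorphisms, subalgebras and quotients -/

/-- The identity homomorphism. -/
def Hom.id (A : Alg S) : Hom A A := ⟨fun x => x, fun _ _ => rfl⟩

/-- Composition of homomorphisms. -/
def Hom.comp {A B C : Alg S} (g : Hom B C) (f : Hom A B) : Hom A C :=
  ⟨fun x => g (f x), fun o x => by simp only [f.map_op, g.map_op]⟩

/-- The inverse of a bijective homomorphism. -/
noncomputable def Hom.inverse {A B : Alg S} (f : Hom A B) (hf : Function.Bijective f) :
    Hom B A where
  toFun := (Equiv.ofBijective f hf).symm
  map_op o x := by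
    apply hf.1
    have h : ∀ y, f ((Equiv.ofBijective f hf).symm y) = y :=
      (Equiv.ofBijective f hf).apply_symm_apply
    rw [f.map_op, h]
    simp only [h]

theorem Hom.inverse_injective {A B : Alg S} (f : Hom A B) (hf : Function.Bijective f) :
    Function.Injective (f.inverse hf) :=
  (Equiv.ofBijective f hf).symm.injective

/-- The subalgebra on a subset closed under the operations. -/
def subalgebra (B : Alg S) (s : Set B)
    (hs : ∀ o (x : S.Arity o → B), (∀ k, x k ∈ s) → B.op o x ∈ s) : Alg S where
  carrier := s
  op o x := ⟨B.op o (fun k => (x k).1), hs o _ (fun k => (x k).2)⟩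

/-- A congruence: an equivalence relation respected by all operations. -/
def IsCongruence (A : Alg S) (r : Setoid A) : Prop :=
  ∀ (o : S.Op) (x y : S.Arity o → A), (∀ k, r (x k) (y k)) → r (A.op o x) (A.op o y)

/-- The quotient of an algebra by an equivalence relation. Its operations are computed on chosen
representatives, so the definition makes sense for every equivalence relation, but the quotient map
is a homomorphism only for congruences. -/
noncomputable def quotient (A : Alg S) (r : Setoid A) : Alg S where
  carrier := Quotient r
  op o x := Quotient.mk r (A.op o (fun k => (x k).out))

/-- The quotient homomorphism of a congruence. -/
noncomputable def quotientMk (A : Alg S) {r : Setoid A} (hr : IsCongruence A r) :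
    Hom A (quotient A r) where
  toFun := Quotient.mk r
  map_op o x := Quotient.sound (hr o _ _ fun k => Setoid.symm (Quotient.mk_out (x k)))

theorem quotientMk_surjective (A : Alg S) {r : Setoid A} (hr : IsCongruence A r) :
    Function.Surjective (quotientMk A hr) :=
  Quotient.mk_surjective

theorem quotientMk_eq_iff (A : Alg S) {r : Setoid A} (hr : IsCongruence A r) {x y : A} :
    quotientMk A hr x = quotientMk A hr y ↔ r x y :=
  Quotient.eq (r := r)

/-- The factorization through a quotient of a homomorphism constant on the classes. -/
def quotientLift {A B : Alg S} {r : Setoid A} (f : Hom A B) (h : ∀ x y, r x y → f x = f y) :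
    Hom (quotient A r) B where
  toFun := Quotient.lift f.toFun h
  map_op o x := by
    refine (f.map_op o fun k => (x k).out).trans (congrArg (B.op o) (funext fun k => ?_))
    exact congrArg (Quotient.lift f.toFun h) (Quotient.out_eq (x k))

theorem Hom.isCongruence_ker {A B : Alg S} (f : Hom A B) : IsCongruence A (Setoid.ker f.toFun) := by
  intro o x y h
  change f (A.op o x) = f (A.op o y)
  rw [f.map_op, f.map_op]
  exact congrArg (B.op o) (funext h)

theorem IsPrevariety.mem_of_injective {P : Set (Alg S)} (hP : IsPrevariety P) {A B : Alg S}
    (hB : B ∈ P) (f : Hom A B) (hf : Function.Injective f) : A ∈ P :=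
  hP.1 ⟨B, hB, f, hf⟩

theorem IsPrevariety.quotient_ker_mem {P : Set (Alg S)} (hP : IsPrevariety P) {A B : Alg S}
    (hB : B ∈ P) (f : Hom A B) : quotient A (Setoid.ker f.toFun) ∈ P := by
  refine hP.mem_of_injective hB (quotientLift f fun _ _ h => h) ?_
  rintro ⟨x⟩ ⟨y⟩ h
  exact Quotient.sound h

theorem Term.eval_hom {A B : Alg S} (f : Hom A B) {V : Type u} (x : V → A) (t : Term S V) :
    t.eval B (fun v => f (x v)) = f (t.eval A x) := by
  induction t with
  | var v => rfl
  | app o t ih => simp only [Term.eval, f.map_op, ih]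

/-! ### Separation of points -/

/-- The points of `A` are separated by homomorphisms into members of `Y`. -/
def IsSeparatedBy (Y : Set (Alg S)) (A : Alg S) : Prop :=
  ∀ x y : A, x ≠ y → ∃ C ∈ Y, ∃ f : Hom A C, f x ≠ f y

theorem IsPrevariety.mem_of_isSeparatedBy {P : Set (Alg S)} (hP : IsPrevariety P) {A : Alg S}
    (hA : IsSeparatedBy P A) : A ∈ P := by
  choose C hC f hf using hA
  let B : {p : A × A // p.1 ≠ p.2} → Alg S := fun p => C p.1.1 p.1.2 p.2
  have hB : prod B ∈ P := hP.2 ⟨_, B, fun p => hC _ _ _, Hom.id _, Function.bijective_id⟩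
  refine hP.mem_of_injective hB
    ⟨fun x p => f p.1.1 p.1.2 p.2 x, fun o x => funext fun p => (f _ _ _).map_op o x⟩ ?_
  intro x y h
  by_contra hxy
  exact hf x y hxy (congrFun h ⟨(x, y), hxy⟩)

theorem isPrevariety_isSeparatedBy (Y : Set (Alg S)) : IsPrevariety {A | IsSeparatedBy Y A} := by
  constructor
  · rintro A ⟨B, hB, f, hf⟩ x y hxy
    obtain ⟨C, hC, g, hg⟩ := hB (f x) (f y) (hf.ne hxy)
    exact ⟨C, hC, g.comp f, hg⟩
  · rintro A ⟨ι, B, hB, f, hf⟩ x y hxy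
    obtain ⟨i, hi⟩ := Function.ne_iff.mp (hf.1.ne hxy)
    obtain ⟨C, hC, g, hg⟩ := hB i _ _ hi
    exact ⟨C, hC, g.comp ⟨fun x => f x i, fun o x => congrFun (f.map_op o x) i⟩, hg⟩

theorem GeneratesPrevariety.separated {Y P : Set (Alg S)} (h : GeneratesPrevariety Y P)
    {A : Alg S} (hA : A ∈ P) : IsSeparatedBy Y A := by
  refine h.2 ⟨isPrevariety_isSeparatedBy Y, fun B hB x y hxy => ?_⟩ hA
  exact ⟨B, hB, Hom.id B, hxy⟩

theorem IsPrevariety.generates_of_separated {Y P : Set (Alg S)} (hP : IsPrevariety P)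
    (hY : Y ⊆ P) (h : ∀ A ∈ P, IsSeparatedBy Y A) : GeneratesPrevariety Y P := by
  refine ⟨⟨hP, hY⟩, fun Q hQ A hA => hQ.1.mem_of_isSeparatedBy fun x y hxy => ?_⟩
  obtain ⟨C, hC, f, hf⟩ := h A hA x y hxy
  exact ⟨C, hQ.2 hC, f, hf⟩

/-! ### Subdirectly irreducible algebras -/

theorem SubdirectlyIrreducible.exists_embedding {Y P : Set (Alg S)} (h : GeneratesPrevariety Y P)
    {A : Alg S} (hA : SubdirectlyIrreducible P A) :
    ∃ B ∈ Y, ∃ f : Hom A B, Function.Injective f := by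
  choose C hC f hf using h.separated hA.1
  let F : (p : {p : A × A // p.1 ≠ p.2}) → Hom A (C p.1.1 p.1.2 p.2) := fun p => f _ _ _
  obtain ⟨p, hp⟩ := hA.2 {p : A × A // p.1 ≠ p.2}
    (fun p => quotient A (Setoid.ker (F p).toFun))
    (fun p => quotientMk A (F p).isCongruence_ker)
    (fun p => h.1.1.quotient_ker_mem (h.1.2 (hC _ _ _)) (F p))
    (fun p => quotientMk_surjective A _)
    (by
      intro x y hxy
      by_contra hne
      exact hf x y hne ((quotientMk_eq_iff A _).mp (hxy ⟨(x, y), hne⟩)))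
  exact ⟨_, hC _ _ _, F p, fun x y hxy => hp.1 ((quotientMk_eq_iff A _).mpr hxy)⟩

theorem SubdirectlyIrreducible.of_bijective {P : Set (Alg S)} (hP : IsPrevariety P) {A B : Alg S}
    (hA : SubdirectlyIrreducible P A) (e : Hom A B) (he : Function.Bijective e) :
    SubdirectlyIrreducible P B := by
  refine ⟨hP.mem_of_injective hA.1 (e.inverse he) (e.inverse_injective he), ?_⟩
  intro ι C f hC hf hsep
  obtain ⟨i, hi⟩ := hA.2 ι C (fun i => (f i).comp e) hC (fun i => (hf i).comp he.2)
    (fun x y h => he.1 (hsep _ _ h))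
  exact ⟨i, (Function.Bijective.of_comp_iff (f i).toFun he).mp hi⟩

/-- The subdirectly irreducible algebras of a residually small prevariety form a set, up to
isomorphism: they are subalgebras of members of a generating set. -/
theorem ResiduallySmall.exists_representatives {P : Set (Alg S)} (h : ResiduallySmall P) :
    ∃ X : Set (Alg S), Small.{u} X ∧ (∀ A ∈ X, SubdirectlyIrreducible P A) ∧
      ∀ A, SubdirectlyIrreducible P A → ∃ B ∈ X, ∃ f : Hom A B, Function.Injective f := by
  obtain ⟨Y, hYs, hY⟩ := h
  let T : Type (u + 1) := (B : Y) ×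
    {s : Set B.1 // ∀ o (x : S.Arity o → B.1), (∀ k, x k ∈ s) → B.1.op o x ∈ s}
  let G : T → Alg S := fun p => subalgebra p.1.1 p.2.1 p.2.2
  have hG : Small.{u} (Set.range G) := small_range G
  refine ⟨Set.range G ∩ {A | SubdirectlyIrreducible P A},
    small_subset Set.inter_subset_left, fun A hA => hA.2, ?_⟩
  intro A hA
  obtain ⟨B, hB, f, hf⟩ := hA.exists_embedding hY
  have hs : ∀ o (x : S.Arity o → B), (∀ k, x k ∈ Set.range f.toFun) →
      B.op o x ∈ Set.range f.toFun := by
    intro o x hx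
    choose y hy using hx
    exact ⟨A.op o y, by rw [f.map_op]; exact congrArg _ (funext hy)⟩
  let e : Hom A (subalgebra B (Set.range f.toFun) hs) :=
    ⟨fun x => ⟨f x, x, rfl⟩, fun o x => Subtype.ext (f.map_op o x)⟩
  have he : Function.Bijective e := by
    refine ⟨fun x y h => hf (congrArg Subtype.val h), ?_⟩
    rintro ⟨_, x, rfl⟩
    exact ⟨x, rfl⟩
  exact ⟨_, ⟨⟨⟨⟨B, hB⟩, ⟨_, hs⟩⟩, rfl⟩, hA.of_bijective hY.1.1 e he⟩, e, he.1⟩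

/-! ### Coproducts -/

/-- The algebra of terms over `V`. -/
def termAlg (S : Signature.{u}) (V : Type u) : Alg S := ⟨Term S V, Term.app⟩

/-- Evaluation of terms at an assignment, as a homomorphism. -/
def evalHom {V : Type u} {C : Alg S} (x : V → C) : Hom (termAlg S V) C :=
  ⟨Term.eval C x, fun _ _ => rfl⟩

/-- Every small family of algebras has a coproduct in a prevariety `P`. No cardinality bound on the
test algebras is needed: the relation divided out quantifies over all of `P`, and only one test
algebra is chosen for each pair of terms not identified. -/
theorem IsPrevariety.exists_isCoproduct {P : Set (Alg S)} (hP : IsPrevariety P) {ι : Type*}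
    [Small.{u} ι] (A : ι → Alg S) :
    ∃ (B : Alg S) (q : (i : ι) → Hom (A i) B), IsCoproduct P A B q := by
  let V : Type u := Shrink.{u} ((i : ι) × A i)
  let ev : (C : Alg S) → ((i : ι) → Hom (A i) C) → V → C :=
    fun C g v => g ((equivShrink _).symm v).1 ((equivShrink _).symm v).2
  let r : Setoid (termAlg S V) :=
    { r := fun s t => ∀ C ∈ P, ∀ g : (i : ι) → Hom (A i) C,
        evalHom (ev C g) s = evalHom (ev C g) t
      iseqv := ⟨fun _ _ _ _ => rfl, fun h C hC g => (h C hC g).symm,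
        fun h h' C hC g => (h C hC g).trans (h' C hC g)⟩ }
  have hr : IsCongruence (termAlg S V) r := by
    intro o s t h C hC g
    rw [Hom.map_op, Hom.map_op]
    exact congrArg _ (funext fun k => h k C hC g)
  have ev_mk : ∀ (C : Alg S) (g : (i : ι) → Hom (A i) C) (i : ι) (x : A i),
      ev C g (equivShrink _ ⟨i, x⟩) = g i x := by
    intro C g i x
    simp only [ev]
    rw [Equiv.symm_apply_apply]
  let B := quotient (termAlg S V) r
  let π : Hom (termAlg S V) B := quotientMk _ hr
  have hπ : Function.Surjective π := quotientMk_surjective _ hr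
  let q : (i : ι) → Hom (A i) B := fun i =>
    { toFun := fun x => π (Term.var (equivShrink _ ⟨i, x⟩))
      map_op := fun o x => by
        refine Eq.trans ?_ (π.map_op o fun k => Term.var (equivShrink _ ⟨i, x k⟩))
        refine (quotientMk_eq_iff _ hr).mpr fun C hC g => ?_
        change ev C g _ = C.op o fun k => ev C g _
        simp only [ev_mk, Hom.map_op] }
  let lift : (C : Alg S) → C ∈ P → ((i : ι) → Hom (A i) C) → Hom B C :=
    fun C hC g => quotientLift (evalHom (ev C g)) fun s t h => h C hC g
  refine ⟨B, q, hP.mem_of_isSeparatedBy fun x y hxy => ?_, fun C hC g => ?_⟩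
  · obtain ⟨s, rfl⟩ := hπ x
    obtain ⟨t, rfl⟩ := hπ y
    by_contra hcon
    push Not at hcon
    refine hxy ((quotientMk_eq_iff _ hr).mpr fun C hC g => ?_)
    exact hcon C hC (lift C hC g)
  · refine ⟨lift C hC g, fun i x => ev_mk C g i x, fun h hh => ?_⟩
    have key : ∀ t : Term S V, h (π t) = evalHom (ev C g) t := by
      intro t
      induction t with
      | var v =>
        obtain ⟨⟨i, x⟩, rfl⟩ := (equivShrink _).surjective v
        exact (hh i x).trans (ev_mk C g i x).symm
      | app o t ih =>
        refine ((congrArg h.toFun (π.map_op o t)).trans (h.map_op o _)).trans ?_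
        exact congrArg (C.op o) (funext ih)
    have hfun : h.toFun = (lift C hC g).toFun := by
      funext b
      obtain ⟨t, rfl⟩ := hπ b
      exact key t
    cases h
    cases hl : lift C hC g
    rw [hl] at hfun
    cases hfun
    rfl

theorem IsPrevariety.compatible_of_embeddings {P X : Set (Alg S)} (hP : IsPrevariety P)
    [Small.{u} X] (hX : X ⊆ P)
    (h : ∀ A : X, ∃ C ∈ P, ∃ g : (A' : X) → Hom A'.1 C, Function.Injective (g A)) :
    Compatible P X := by
  obtain ⟨B, q, hq⟩ := hP.exists_isCoproduct fun A : X => A.1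
  refine ⟨hX, B, q, hq, fun A x y hxy => ?_⟩
  obtain ⟨C, hC, g, hg⟩ := h A
  obtain ⟨k, hk, -⟩ := hq.2 C hC g
  apply hg
  rw [← hk, ← hk, hxy]

theorem GeneratedByAtMost.decomposesIntoCompatible {P : Set (Alg S)} {κ : Cardinal.{u}}
    (h : GeneratedByAtMost P κ) : DecomposesIntoCompatible P κ := by
  obtain ⟨Y, hYκ, hY⟩ := h
  have he : Nonempty (Y ↪ κ.out) := by
    refine Cardinal.lift_mk_le'.{u + 1, u}.mp ?_
    rw [Cardinal.mk_out]
    exact (Cardinal.lift_id'.{u, u + 1} _).le.trans hYκ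
  obtain ⟨e⟩ := he
  intro X hX hSI
  -- Indices outside the range of `e` receive the empty set, which is compatible.
  refine ⟨fun α => {A ∈ X | ∃ y : Y, e y = α ∧ ∃ f : Hom A y.1, Function.Injective f}, ?_, ?_⟩
  · ext A
    simp only [Set.mem_iUnion, Set.mem_sep_iff]
    constructor
    · intro hA
      obtain ⟨B, hB, hf⟩ := (hSI A hA).exists_embedding hY
      exact ⟨e ⟨B, hB⟩, hA, ⟨B, hB⟩, rfl, hf⟩
    · rintro ⟨_, hA, -⟩
      exact hA
  · intro α
    have : Small.{u} {A ∈ X | ∃ y : Y, e y = α ∧ ∃ f : Hom A y.1, Function.Injective f} :=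
      small_subset (Set.sep_subset _ _)
    refine hY.1.1.compatible_of_embeddings (fun A hA => (hSI A hA.1).1) ?_
    rintro ⟨A, hA, y, rfl, hf⟩
    have hmap : ∀ A' : {A ∈ X | ∃ z : Y, e z = e y ∧ ∃ f : Hom A z.1, Function.Injective f},
        ∃ f : Hom A'.1 y.1, Function.Injective f := by
      rintro ⟨A', -, z, hz, hf'⟩
      obtain rfl := e.injective hz
      exact hf'
    choose g hg using hmap
    exact ⟨y.1, hY.1.2 y.2, g, hg _⟩

/-! ### Subdirect decomposition in quasivarieties -/

theorem exists_forall_mem_of_isChain {α J : Type*} [Finite J] {c : Set (Setoid α)}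
    (hc : IsChain (· ≤ ·) c) (hne : c.Nonempty) {x y : J → α}
    (h : ∀ j, ∃ r ∈ c, r (x j) (y j)) : ∃ r ∈ c, ∀ j, r (x j) (y j) := by
  choose f hf hxy using h
  have : Nonempty c := hne.to_subtype
  obtain ⟨r, hr⟩ := (directedOn_iff_directed.mp hc.directedOn).finite_le fun j => ⟨f j, hf j⟩
  exact ⟨r.1, r.2, fun j => hr j (hxy j)⟩

/-- The union of a nonempty chain of equivalence relations. -/
def chainUnion {α : Type*} {c : Set (Setoid α)} (hc : IsChain (· ≤ ·) c) (hne : c.Nonempty) :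
    Setoid α where
  r x y := ∃ r ∈ c, r x y
  iseqv :=
    { refl := fun x => ⟨hne.some, hne.some_mem, hne.some.refl x⟩
      symm := fun ⟨r, hr, h⟩ => ⟨r, hr, r.symm h⟩
      trans := by
        rintro x y z ⟨r, hr, h⟩ ⟨s, hs, h'⟩
        rcases hc.total hr hs with hrs | hsr
        · exact ⟨s, hs, s.trans (hrs h) h'⟩
        · exact ⟨r, hr, r.trans h (hsr h')⟩ }

theorem isCongruence_chainUnion {A : Alg S} (hS : ∀ o : S.Op, Finite (S.Arity o))
    {c : Set (Setoid A)} (hc : IsChain (· ≤ ·) c) (hne : c.Nonempty)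
    (hcong : ∀ r ∈ c, IsCongruence A r) : IsCongruence A (chainUnion hc hne) := by
  intro o x y h
  have := hS o
  obtain ⟨r, hr, hxy⟩ := exists_forall_mem_of_isChain hc hne h
  exact ⟨r, hr, hcong r hr o x y hxy⟩

theorem IsQuasivariety.quotient_chainUnion_mem {P : Set (Alg S)} (hP : IsQuasivariety P)
    {A : Alg S} {c : Set (Setoid A)} (hc : IsChain (· ≤ ·) c) (hne : c.Nonempty)
    (hcong : ∀ r ∈ c, IsCongruence A r) (hmem : ∀ r ∈ c, quotient A r ∈ P) :
    quotient A (chainUnion hc hne) ∈ P := by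
  obtain ⟨hS, -, H, hfin, rfl⟩ := hP
  have hu := isCongruence_chainUnion hS hc hne hcong
  intro h hH x hx
  have := (hfin h hH).2
  -- Lift the assignment to `A`; the finitely many premises then hold modulo one member of `c`.
  obtain ⟨y, rfl⟩ : ∃ y : h.I → A, (fun i => quotientMk A hu (y i)) = x := by
    choose y hy using fun i => quotientMk_surjective A hu (x i)
    exact ⟨y, funext hy⟩
  simp only [Term.eval_hom, quotientMk_eq_iff] at hx ⊢
  obtain ⟨r, hr, hxr⟩ := exists_forall_mem_of_isChain hc hne hx
  have key := hmem r hr h hH fun i => quotientMk A (hcong r hr) (y i)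
  simp only [Term.eval_hom, quotientMk_eq_iff] at key
  exact ⟨r, hr, key hxr⟩

/-- Birkhoff's subdirect decomposition: distinct points of a member of a quasivariety are separated
by a homomorphism to a subdirectly irreducible, namely the quotient by a maximal congruence among
those with quotient in `P` that do not identify the two points. -/
theorem IsQuasivariety.exists_subdirectlyIrreducible {P : Set (Alg S)} (hP : IsQuasivariety P)
    {A : Alg S} (hA : A ∈ P) {x y : A} (hxy : x ≠ y) :
    ∃ B, SubdirectlyIrreducible P B ∧ ∃ f : Hom A B, f x ≠ f y := by
  let Z : Set (Setoid A) := {r | IsCongruence A r ∧ quotient A r ∈ P ∧ ¬ r x y}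
  have hchain : ∀ c ⊆ Z, IsChain (· ≤ ·) c → ∀ r ∈ c, ∃ ub ∈ Z, ∀ z ∈ c, z ≤ ub := by
    intro c hcZ hc r hr
    refine ⟨chainUnion hc ⟨r, hr⟩,
      ⟨isCongruence_chainUnion hP.1 hc _ fun s hs => (hcZ hs).1,
        hP.quotient_chainUnion_mem hc _ (fun s hs => (hcZ hs).1) fun s hs => (hcZ hs).2.1, ?_⟩,
      fun z hz a b hab => ⟨z, hz, hab⟩⟩
    rintro ⟨s, hs, h⟩
    exact (hcZ hs).2.2 h
  obtain ⟨r, -, hr⟩ := zorn_le_nonempty₀ Z hchain (Setoid.ker (Hom.id A).toFun)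
    ⟨(Hom.id A).isCongruence_ker, hP.2.1.quotient_ker_mem hA _, hxy⟩
  obtain ⟨hcong, hmem, hrxy⟩ := hr.prop
  let π := quotientMk A hcong
  refine ⟨quotient A r, ⟨hmem, ?_⟩, π, fun h => hrxy ((quotientMk_eq_iff A hcong).mp h)⟩
  intro ι B f hB hf hsep
  -- Some `f i` keeps `x` and `y` apart; by maximality it identifies nothing more.
  obtain ⟨i, hi⟩ : ∃ i, f i (π x) ≠ f i (π y) := by
    by_contra! hcon
    exact hrxy ((quotientMk_eq_iff A hcong).mp (hsep _ _ hcon))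
  have hle : r ≤ Setoid.ker ((f i).comp π).toFun := fun a b hab =>
    congrArg (f i).toFun ((quotientMk_eq_iff A hcong).mpr hab)
  have hge := hr.le_of_ge (y := Setoid.ker ((f i).comp π).toFun)
    ⟨((f i).comp π).isCongruence_ker, hP.2.1.quotient_ker_mem (hB i) _, hi⟩ hle
  refine ⟨i, fun a b hab => ?_, hf i⟩
  obtain ⟨a, rfl⟩ := quotientMk_surjective A hcong a
  obtain ⟨b, rfl⟩ := quotientMk_surjective A hcong b
  exact (quotientMk_eq_iff A hcong).mpr (hge hab)

theorem IsQuasivariety.generatedByAtMost {P : Set (Alg S)} (hP : IsQuasivariety P)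
    (hsmall : ResiduallySmall P) {κ : Cardinal.{u}} (h : DecomposesIntoCompatible P κ) :
    GeneratedByAtMost P κ := by
  obtain ⟨X, hXs, hXSI, hX⟩ := hsmall.exists_representatives
  obtain ⟨F, hF, hcomp⟩ := h X hXs hXSI
  choose _ B q hB hq using hcomp
  refine ⟨Set.range B, ?_, hP.2.1.generates_of_separated ?_ fun A hA x y hxy => ?_⟩
  · refine (Cardinal.lift_id'.{u, u + 1} _).ge.trans (Cardinal.mk_range_le_lift.trans ?_)
    rw [Cardinal.mk_out]
  · rintro _ ⟨α, rfl⟩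
    exact (hB α).1
  · obtain ⟨C, hC, f, hf⟩ := hP.exists_subdirectlyIrreducible hA hxy
    obtain ⟨D, hD, e, he⟩ := hX C hC
    rw [hF, Set.mem_iUnion] at hD
    obtain ⟨α, hα⟩ := hD
    exact ⟨B α, ⟨α, rfl⟩, ((q α ⟨D, hα⟩).comp e).comp f,
      fun h => hf (he (hq α ⟨D, hα⟩ h))⟩

end UnivAlg

theorem theorem7p2 {S : UnivAlg.Signature.{u}} (P : Set (UnivAlg.Alg S))
    (hP : UnivAlg.IsPrevariety P) (hsmall : UnivAlg.ResiduallySmall P) (κ : Cardinal.{u}) :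
    (UnivAlg.GeneratedByAtMost P κ → UnivAlg.DecomposesIntoCompatible P κ) ∧
    (UnivAlg.IsQuasivariety P →
      (UnivAlg.GeneratedByAtMost P κ ↔ UnivAlg.DecomposesIntoCompatible P κ)) :=
  ⟨UnivAlg.GeneratedByAtMost.decomposesIntoCompatible, fun hQ =>
    ⟨UnivAlg.GeneratedByAtMost.decomposesIntoCompatible, hQ.generatedByAtMost hsmall⟩⟩
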